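/- Let $X$ be a real Banach space with closed unit ball $B_X$, unit sphere $S_X$ and dual $X^*$. For $x\in S_X$ let $J(x)=\{x^*\in S_{X^*}: x^*(x)=1\}$, and for $x^*\in S_{X^*}$ let $S(X,x^*,0)=\{y\in B_X: x^*(y)\ge 1\}$. The space $X$ is called HLUR if for all $x\in S_X$, every sequence $(x_n)$ in $S_X$ with $\|x_n+x\|\to 2$ and every $x^*\in J(x)$ we have $d(x_n,S(X,x^*,0))\to 0$. It has property (I) if every nonempty closed bounded convex subset of $X$ is the intersection of a family of closed balls. For a nonempty bounded set $K\subseteq X$ and $x\in X$ put $$F_K(x)=\Bigl\{k\in K:\ \|x-k\|=\sup_{k'\in K}\|x-k'\|\Bigr\},\qquad \operatorname{Far}K=\bigcup_{x\in X}F_K(x).$$ Let $X$ be reflexive and HLUR, and let $K\subseteq X$ be nonempty, bounded and weakly sequentially closed (that is, $K$ contains the limit of every weakly convergent sequence of its points). Then: (a) the set $A=\{x\in X: F_K(x)\neq\emptyset\}$ is dense in $X$, and $X\setminus A$ is of first category in $X$; (b) if $X$ has property (I), then $\overline{\operatorname{co}}(K)=\overline{\operatorname{co}}(\operatorname{Far}K)$,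 where $\overline{\operatorname{co}}$ denotes the closed convex hull. -/

import Mathlib

open Set Filter Topology

noncomputable section

/-- `X` is reflexive: the canonical embedding into the bidual is onto. -/
def IsReflexiveSpace (X : Type*) [NormedAddCommGroup X] [NormedSpace ℝ X] : Prop :=
  Function.Surjective (NormedSpace.inclusionInDoubleDual ℝ X)

/-- The slice `S(X, x*, δ) = {y ∈ B_X : x*(y) ≥ 1 - δ}` of the closed unit ball. -/
def unitBallSlice {X : Type*} [NormedAddCommGroup X] [NormedSpace ℝ X]
    (f : StrongDual ℝ X) (δ : ℝ) : Set X :=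
  {y | y ∈ Metric.closedBall (0 : X) 1 ∧ 1 - δ ≤ f y}

/-- The set `J(x)` of norm-one functionals `x*` with `x*(x) = 1`. -/
def supportFunctionals {X : Type*} [NormedAddCommGroup X] [NormedSpace ℝ X]
    (x : X) : Set (StrongDual ℝ X) :=
  {f | f ∈ Metric.sphere (0 : StrongDual ℝ X) 1 ∧ f x = 1}

/-- Property (HLUR). The slice `S(X, x*, 0)` contains `x`, so the distance to it is the
genuine one. -/
def IsHLUR (X : Type*) [NormedAddCommGroup X] [NormedSpace ℝ X] : Prop :=
  ∀ x ∈ Metric.sphere (0 : X) 1, ∀ u : ℕ → X, (∀ n, u n ∈ Metric.sphere (0 : X) 1) →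
    Tendsto (fun n => ‖u n + x‖) atTop (𝓝 2) →
    ∀ f ∈ supportFunctionals x,
      Tendsto (fun n => Metric.infDist (u n) (unitBallSlice f 0)) atTop (𝓝 0)

/-- Property (I): every (nonempty) closed bounded convex set is the intersection of a family of
closed balls. The family is given by its set of pairs (centre, radius). In a nonzero space the
empty set is always the intersection of two disjoint balls, so that non-emptiness only matters
for the zero space. -/
def HasPropertyI (X : Type*) [NormedAddCommGroup X] [NormedSpace ℝ X] : Prop :=
  ∀ C : Set X, C.Nonempty → IsClosed C → Bornology.IsBounded C → Convex ℝ C →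
    ∃ P : Set (X × ℝ), (∀ p ∈ P, 0 < p.2) ∧ C = ⋂ p ∈ P, Metric.closedBall p.1 p.2

/-- `F_K(x)`: the points of `K` at which the farthest distance from `x` to `K` is attained. -/
def farthestPoints {X : Type*} [NormedAddCommGroup X] (K : Set X) (x : X) : Set X :=
  {k | k ∈ K ∧ ‖x - k‖ = sSup {d : ℝ | ∃ k' ∈ K, d = ‖x - k'‖}}

/-- `Far K`, the union of all the sets `F_K(x)`. -/
def farSet {X : Type*} [NormedAddCommGroup X] (K : Set X) : Set X :=
  ⋃ x : X, farthestPoints K x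

/-- `K` is closed under weak limits of sequences. -/
def IsWeaklySeqClosed {X : Type*} [NormedAddCommGroup X] [NormedSpace ℝ X] (K : Set X) : Prop :=
  IsSeqClosed (toWeakSpace ℝ X '' K)

end

/-! Write `r` for `farDist K`, a convex 1-Lipschitz function. A subgradient `f` of `r` at `x` has
norm at most one, so `f (x - k) ≤ ‖x - k‖ ≤ r x` on `K`. If `f (x - k)` comes arbitrarily close to
`r x`, reflexivity and weak sequential closedness of `K` make it reach `r x` at some `k`, which is
then farthest from `x`. Every other `x` lies in some `deficientSet K (1 / (n + 1))`. These sets are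
closed (`isClosed_deficientSet`) with empty interior (`interior_deficientSet`), so Baire gives (a).
For (b), density and the Lipschitz bound show that a closed ball containing `Far K` contains `K`;
property (I) concludes. -/

section WeakSequentialCompactness

variable {X : Type*} [NormedAddCommGroup X] [NormedSpace ℝ X]

/-- A separable set of a normed space is separated from the origin by countably many
functionals. -/
lemma exists_seq_dual_separating {Y : Set X} (hY : TopologicalSpace.IsSeparable Y)
    (hne : Y.Nonempty) :
    ∃ g : ℕ → StrongDual ℝ X, ∀ y ∈ Y, (∀ n, g n y = 0) → y = 0 := by
  obtain ⟨c, hc, hYc⟩ := hY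
  have hcne : c.Nonempty := by
    rw [← closure_nonempty_iff]
    exact hne.mono hYc
  obtain ⟨d, rfl⟩ := hc.exists_eq_range hcne
  choose g hg hgd using fun n => exists_dual_vector'' ℝ (d n)
  refine ⟨g, fun y hy h0 => ?_⟩
  by_contra hne
  have hpos : 0 < ‖y‖ := norm_pos_iff.2 hne
  obtain ⟨_, ⟨n, rfl⟩, hn⟩ := Metric.mem_closure_iff.1 (hYc hy) (‖y‖ / 2) (by positivity)
  have h1 : ‖d n‖ ≤ ‖d n - y‖ := by
    have h2 : g n (d n - y) = ‖d n‖ := by simp [map_sub, h0 n, hgd n]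
    rw [← h2]
    calc g n (d n - y) ≤ ‖g n (d n - y)‖ := Real.le_norm_self _
      _ ≤ 1 * ‖d n - y‖ := (g n).le_of_opNorm_le (hg n) _
      _ = ‖d n - y‖ := one_mul _
  have h3 : ‖y‖ ≤ ‖y - d n‖ + ‖d n‖ := by simpa using norm_add_le (y - d n) (d n)
  rw [dist_eq_norm] at hn
  rw [norm_sub_rev] at h1
  linarith

/-- In a reflexive space, bounded sets are relatively weakly compact. -/
lemma IsReflexiveSpace.isCompact_closure_weakSpace (hrefl : IsReflexiveSpace X)
    {S : Set (WeakSpace ℝ X)} (hS : Bornology.IsBounded (toWeakSpace ℝ X ⁻¹' S)) :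
    IsCompact (closure S) := by
  refine NormedSpace.isCompact_closure_of_isBounded ℝ X S hS fun z _ => ?_
  obtain ⟨x, hx⟩ := hrefl (WeakDual.toStrongDual z)
  exact ⟨toWeakSpace ℝ X x, DFunLike.ext _ _ fun f => congrArg (fun F => F f) hx⟩

/-- In a reflexive space, every bounded sequence has a weakly convergent subsequence. -/
theorem IsReflexiveSpace.exists_weakly_convergent_subseq (hrefl : IsReflexiveSpace X)
    {u : ℕ → X} (hu : Bornology.IsBounded (range u)) :
    ∃ (p : X) (φ : ℕ → ℕ), StrictMono φ ∧
      Tendsto (fun n => toWeakSpace ℝ X (u (φ n))) atTop (𝓝 (toWeakSpace ℝ X p)) := by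
  set S : Set (WeakSpace ℝ X) := toWeakSpace ℝ X '' range u with hSdef
  have hcomp : IsCompact (closure S) := hrefl.isCompact_closure_weakSpace (by
    rwa [hSdef, preimage_image_eq _ (toWeakSpace ℝ X).injective])
  set V : Submodule ℝ X := Submodule.span ℝ (range u)
  set Y : Submodule ℝ X := V.topologicalClosure
  have hYsep : TopologicalSpace.IsSeparable (Y : Set X) := by
    rw [Submodule.topologicalClosure_coe]
    exact ((countable_range u).isSeparable.span (R := ℝ)).closure
  -- By Mazur, the norm-closed span is weakly closed, so the weak closure of the sequence stays in a
  -- separable space.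
  have hsub : closure S ⊆ toWeakSpace ℝ X '' (Y : Set X) := by
    have h := (V.convex (𝕜 := ℝ)).toWeakSpace_closure ℝ
    rw [Submodule.topologicalClosure_coe, h]
    exact closure_mono (image_mono Submodule.subset_span)
  obtain ⟨g, hg⟩ := exists_seq_dual_separating hYsep ⟨0, Y.zero_mem⟩
  have : CompactSpace (closure S) := isCompact_iff_compactSpace.1 hcomp
  have hev : ∀ f : StrongDual ℝ X, Continuous fun w : WeakSpace ℝ X => f ((toWeakSpace ℝ X).symm w) :=
    fun f => WeakBilin.eval_continuous _ f
  have : TopologicalSpace.MetrizableSpace (closure S) := by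
    refine Metric.PiNatEmbed.TopologicalSpace.MetrizableSpace.of_countable_separating
      (fun n (w : closure S) => g n ((toWeakSpace ℝ X).symm w))
      (fun n => (hev (g n)).comp continuous_subtype_val) ?_
    rintro ⟨a, ha⟩ ⟨b, hb⟩ hab
    obtain ⟨a, haY, rfl⟩ := hsub ha
    obtain ⟨b, hbY, rfl⟩ := hsub hb
    by_contra! hcon
    have h0 : a - b = 0 := hg _ (Y.sub_mem haY hbY) fun n => by
      simpa [sub_eq_zero] using hcon n
    exact hab (Subtype.ext (congrArg (toWeakSpace ℝ X) (sub_eq_zero.1 h0)))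
  obtain ⟨q, φ, hφ, hlim⟩ := CompactSpace.tendsto_subseq
    (fun n => (⟨toWeakSpace ℝ X (u n), subset_closure ⟨u n, ⟨n, rfl⟩, rfl⟩⟩ : closure S))
  exact ⟨(toWeakSpace ℝ X).symm q, φ, hφ,
    (continuous_subtype_val.tendsto q).comp hlim⟩

/-- On a bounded weakly sequentially closed set of a reflexive space, every functional attains
its infimum. -/
lemma IsReflexiveSpace.exists_forall_le (hrefl : IsReflexiveSpace X) {K : Set X}
    (hbdd : Bornology.IsBounded K) (hK : IsWeaklySeqClosed K) (f : StrongDual ℝ X) {m : ℝ}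
    (hm : ∀ n : ℕ, ∃ k ∈ K, f k < m + 1 / ((n : ℝ) + 1)) : ∃ k ∈ K, f k ≤ m := by
  choose u huK hu using hm
  obtain ⟨p, φ, hφ, hlim⟩ := hrefl.exists_weakly_convergent_subseq
    (hbdd.subset (range_subset_iff.2 huK))
  obtain ⟨k, hk, hkp⟩ := hK (fun n => mem_image_of_mem _ (huK (φ n))) hlim
  obtain rfl : k = p := (toWeakSpace ℝ X).injective hkp
  have h1 : Tendsto (fun n => f (u (φ n))) atTop (𝓝 (f k)) :=
    ((WeakBilin.eval_continuous (topDualPairing ℝ X).flip f).tendsto _).comp hlim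
  have h2 : Tendsto (fun n => m + 1 / ((φ n : ℝ) + 1)) atTop (𝓝 (m + 0)) :=
    tendsto_const_nhds.add (tendsto_one_div_add_atTop_nhds_zero_nat.comp hφ.tendsto_atTop)
  exact ⟨k, hk, by simpa using le_of_tendsto_of_tendsto' h1 h2 fun n => (hu (φ n)).le⟩

end WeakSequentialCompactness

section Subgradient

variable {X : Type*} [NormedAddCommGroup X] [NormedSpace ℝ X]

/-- A continuous convex function has a subgradient at every point. -/
theorem ConvexOn.exists_subgradient {r : X → ℝ} (hr : ConvexOn ℝ univ r) (hc : Continuous r)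
    (x : X) : ∃ f : StrongDual ℝ X, ∀ y, r x + f (y - x) ≤ r y := by
  have hconv : Convex ℝ {p : X × ℝ | r p.1 < p.2} := by
    simpa using hr.convex_strict_epigraph
  have hopen : IsOpen {p : X × ℝ | r p.1 < p.2} :=
    isOpen_lt (hc.comp continuous_fst) continuous_snd
  obtain ⟨F, hF⟩ := geometric_hahn_banach_open_point (x := (x, r x)) hconv hopen (by simp)
  set a : StrongDual ℝ X := F.comp (ContinuousLinearMap.inl ℝ X ℝ) with ha
  set c : ℝ := F (0, 1) with hcdef
  have hFeq : ∀ y t, F (y, t) = a y + t * c := by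
    intro y t
    have : ((y, t) : X × ℝ) = (y, 0) + t • ((0 : X), (1 : ℝ)) := by simp
    rw [this, map_add, map_smul]
    simp [ha, hcdef]
  have hc0 : c < 0 := by
    have := hF (x, r x + 1) (by simp)
    rw [hFeq, hFeq] at this
    linarith
  refine ⟨(-c)⁻¹ • a, fun y => ?_⟩
  have hmul : a (y - x) ≤ (-c) * (r y - r x) := by
    -- The point `(y, r y)` is not in the strict epigraph; raising it by `ε / (-c)` costs exactly
    -- `ε`.
    refine le_of_forall_pos_lt_add fun ε hε => ?_
    have := hF (y, r y + ε / (-c)) (by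
      have : 0 < ε / (-c) := div_pos hε (by linarith)
      simpa using this)
    rw [hFeq, hFeq] at this
    have h2 : ε / (-c) * c = -ε := by
      rw [div_neg, neg_mul, div_mul_cancel₀ _ hc0.ne]
    rw [map_sub]
    linarith
  have : (-c)⁻¹ * a (y - x) ≤ r y - r x := by
    rw [inv_mul_le_iff₀ (by linarith)]
    exact hmul
  simp only [smul_apply, smul_eq_mul]
  linarith

/-- A subgradient of a `1`-Lipschitz function has norm at most one. -/
lemma norm_le_one_of_subgradient {r : X → ℝ} (hr : LipschitzWith 1 r) {x : X}
    {f : StrongDual ℝ X} (hf : ∀ y, r x + f (y - x) ≤ r y) : ‖f‖ ≤ 1 := by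
  have key : ∀ v, f v ≤ ‖v‖ := fun v => by
    have h1 := hf (x + v)
    have h2 := hr.le_add_mul (x + v) x
    simp only [add_sub_cancel_left, NNReal.coe_one, one_mul, dist_eq_norm] at h1 h2
    linarith
  refine f.opNorm_le_bound zero_le_one fun v => ?_
  rw [one_mul, Real.norm_eq_abs, abs_le]
  have := key (-v)
  rw [map_neg, norm_neg] at this
  exact ⟨by linarith, key v⟩

end Subgradient

section FarthestDistance

variable {X : Type*} [NormedAddCommGroup X]

/-- The farthest distance `sup_{k ∈ K} ‖x - k‖` from `x` to `K`. -/
noncomputable def farDist (K : Set X) (x : X) : ℝ := sSup {d : ℝ | ∃ k' ∈ K, d = ‖x - k'‖}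

variable {K : Set X}

lemma norm_sub_le_farDist (hbdd : Bornology.IsBounded K) (x : X) {k : X} (hk : k ∈ K) :
    ‖x - k‖ ≤ farDist K x := by
  refine le_csSup ?_ ⟨k, hk, rfl⟩
  obtain ⟨R, hR⟩ := hbdd.exists_norm_le
  refine ⟨‖x‖ + R, ?_⟩
  rintro _ ⟨k', hk', rfl⟩
  exact (norm_sub_le _ _).trans (by gcongr; exact hR k' hk')

lemma farDist_le (hne : K.Nonempty) {x : X} {M : ℝ} (h : ∀ k ∈ K, ‖x - k‖ ≤ M) :
    farDist K x ≤ M := by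
  obtain ⟨k, hk⟩ := hne
  refine csSup_le ⟨_, k, hk, rfl⟩ ?_
  rintro _ ⟨k', hk', rfl⟩
  exact h k' hk'

lemma exists_lt_norm_sub (hne : K.Nonempty) {x : X} {M : ℝ} (h : M < farDist K x) :
    ∃ k ∈ K, M < ‖x - k‖ := by
  by_contra! hcon
  exact h.not_ge (farDist_le hne hcon)

lemma farDist_le_add (hne : K.Nonempty) (hbdd : Bornology.IsBounded K) (x y : X) :
    farDist K x ≤ farDist K y + ‖x - y‖ := by
  refine farDist_le hne fun k hk => ?_
  have h := norm_sub_le_farDist hbdd y hk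
  have h2 := norm_sub_le_norm_sub_add_norm_sub x y k
  linarith

lemma lipschitzWith_farDist (hne : K.Nonempty) (hbdd : Bornology.IsBounded K) :
    LipschitzWith 1 (farDist K) :=
  LipschitzWith.of_le_add fun x y => by
    rw [dist_eq_norm]; exact farDist_le_add hne hbdd x y

lemma farSet_subset : farSet K ⊆ K := iUnion_subset fun _ _ hk => hk.1

variable [NormedSpace ℝ X]

lemma convexOn_farDist (hne : K.Nonempty) (hbdd : Bornology.IsBounded K) :
    ConvexOn ℝ univ (farDist K) := by
  refine ⟨convex_univ, fun x _ y _ a b ha hb hab => farDist_le hne fun k hk => ?_⟩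
  have hk' : a • x + b • y - k = a • (x - k) + b • (y - k) := by
    rw [smul_sub, smul_sub, sub_add_sub_comm, ← add_smul, hab, one_smul]
  calc ‖a • x + b • y - k‖ ≤ ‖a • (x - k)‖ + ‖b • (y - k)‖ := hk' ▸ norm_add_le _ _
    _ = a * ‖x - k‖ + b * ‖y - k‖ := by
      rw [norm_smul_of_nonneg ha, norm_smul_of_nonneg hb]
    _ ≤ a • farDist K x + b • farDist K y := by
      simp only [smul_eq_mul]
      gcongr <;> exact norm_sub_le_farDist hbdd _ hk

/-- The points at which some subgradient of the farthest distance misses it by at least `δ`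
on `K`. -/
def deficientSet (K : Set X) (δ : ℝ) : Set X :=
  {x | ∃ f : StrongDual ℝ X, ‖f‖ ≤ 1 ∧ (∀ y, farDist K x + f (y - x) ≤ farDist K y) ∧
    ∀ k ∈ K, f (x - k) ≤ farDist K x - δ}

/-- By Banach–Alaoglu, the witnessing functionals have a weak-* limit, which inherits both
inequalities. -/
lemma isClosed_deficientSet (hne : K.Nonempty) (hbdd : Bornology.IsBounded K) (δ : ℝ) :
    IsClosed (deficientSet K δ) := by
  rw [isClosed_iff_ultrafilter]
  intro x U hU hmem
  have hex : ∀ z : X, ∃ f : StrongDual ℝ X, ‖f‖ ≤ 1 ∧ (z ∈ deficientSet K δ →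
      (∀ y, farDist K z + f (y - z) ≤ farDist K y) ∧
        ∀ k ∈ K, f (z - k) ≤ farDist K z - δ) := by
    intro z
    by_cases hz : z ∈ deficientSet K δ
    · obtain ⟨f, h1, h2, h3⟩ := hz
      exact ⟨f, h1, fun _ => ⟨h2, h3⟩⟩
    -- The value off the set is immaterial: `U` concentrates on the deficient set.
    · exact ⟨0, by simp, fun h => absurd h hz⟩
  choose g hg1 hg using hex
  obtain ⟨f, hfball, hf⟩ := (WeakDual.isCompact_closedBall (𝕜 := ℝ) (0 : StrongDual ℝ X)
    1).ultrafilter_le_nhds (U.map fun z => StrongDual.toWeakDual (g z)) (by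
      simp only [le_principal_iff, Ultrafilter.mem_coe, Ultrafilter.mem_map]
      exact Filter.univ_mem' fun z => by simpa using hg1 z)
  have hpt : ∀ v, Tendsto (fun z => g z v) U (𝓝 (f v)) := fun v =>
    ((WeakDual.eval_continuous v).tendsto f).comp hf
  have hr : Tendsto (farDist K) U (𝓝 (farDist K x)) :=
    ((lipschitzWith_farDist hne hbdd).continuous.tendsto x).mono_left hU
  -- Weak-* convergence only handles fixed vectors; the uniform norm bound absorbs the moving base
  -- point.
  have hself : Tendsto (fun z => g z (z - x)) U (𝓝 0) := by
    refine squeeze_zero_norm (a := fun z => ‖z - x‖) (fun z => ?_) ?_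
    · simpa using (g z).le_of_opNorm_le (hg1 z) (z - x)
    · exact tendsto_iff_norm_sub_tendsto_zero.1 (tendsto_id.mono_left hU)
  refine ⟨WeakDual.toStrongDual f, by simpa using hfball, fun y => ?_, fun k hk => ?_⟩
  · have h1 : Tendsto (fun z => farDist K z + g z (y - z)) U
        (𝓝 (farDist K x + (f (y - x) - 0))) := by
      refine hr.add (((hpt (y - x)).sub hself).congr fun z => ?_)
      rw [← map_sub]; congr 1; abel
    rw [sub_zero] at h1
    refine le_of_tendsto h1 ?_
    filter_upwards [hmem] with z hz using (hg z hz).1 y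
  · have h1 : Tendsto (fun z => g z (z - k)) U (𝓝 (f (x - k) + 0)) := by
      refine ((hpt (x - k)).add hself).congr fun z => ?_
      rw [← map_add]; congr 1; abel
    rw [add_zero] at h1
    refine le_of_tendsto_of_tendsto h1 (hr.sub_const δ) ?_
    filter_upwards [hmem] with z hz using (hg z hz).2 k hk

/-- **Lau's lemma**: the deficient sets have empty interior. -/
lemma interior_deficientSet (hne : K.Nonempty) (hbdd : Bornology.IsBounded K) {δ : ℝ}
    (hδ : 0 < δ) : interior (deficientSet K δ) = ∅ := by
  rw [eq_empty_iff_forall_notMem]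
  intro y hy
  obtain ⟨ρ, hρ, hball⟩ := Metric.isOpen_iff.1 isOpen_interior y hy
  obtain ⟨k₁, hk₁⟩ := hne
  have hr0 : 0 ≤ farDist K y := (norm_nonneg _).trans (norm_sub_le_farDist hbdd y hk₁)
  obtain ⟨t, ht, htρ⟩ : ∃ t : ℝ, 0 < t ∧ t * farDist K y < ρ := by
    refine ⟨ρ / (farDist K y + 1), by positivity, ?_⟩
    rw [div_mul_eq_mul_div, div_lt_iff₀ (by positivity)]
    nlinarith
  -- Move from `y` directly away from a nearly farthest `k`. The value of `r` there exceeds `(1 + t)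
  -- * r y - t * δ`, whereas the subgradient inequality at `y` and deficiency at `k` bound it above
  -- by that number.
  obtain ⟨k, hk, hlt⟩ := exists_lt_norm_sub ⟨k₁, hk₁⟩
    (show farDist K y - t * δ / (1 + t) < farDist K y by
      have : 0 < t * δ / (1 + t) := by positivity
      linarith)
  have hle := norm_sub_le_farDist hbdd y hk
  obtain ⟨f, -, hsub, hdef⟩ := interior_subset (hball (show y + t • (y - k) ∈ _ by
    rw [Metric.mem_ball, dist_eq_norm, add_sub_cancel_left, norm_smul_of_nonneg ht.le]
    exact (mul_le_mul_of_nonneg_left hle ht.le).trans_lt htρ))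
  have hxk : y + t • (y - k) - k = (1 + t) • (y - k) := by
    rw [add_smul, one_smul]; abel
  have h1 := hsub y
  have h2 := hdef k hk
  have h3 := norm_sub_le_farDist hbdd (y + t • (y - k)) hk
  rw [hxk, norm_smul_of_nonneg (by linarith)] at h3
  rw [hxk, map_smul, smul_eq_mul] at h2
  rw [sub_add_cancel_left, map_neg, map_smul, smul_eq_mul] at h1
  set R := farDist K (y + t • (y - k))
  have h4 : (1 + t) * (farDist K y - t * δ / (1 + t)) < (1 + t) * ‖y - k‖ :=
    mul_lt_mul_of_pos_left hlt (by linarith)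
  have h5 : (1 + t) * (t * δ / (1 + t)) = t * δ := by field_simp
  nlinarith [mul_le_mul_of_nonneg_left h2 ht.le,
    mul_le_mul_of_nonneg_left h1 (show 0 ≤ 1 + t by linarith)]

/-- In a reflexive space, a point outside every deficient set has a farthest point in a bounded
weakly sequentially closed set. -/
lemma farthestPoints_nonempty (hrefl : IsReflexiveSpace X) (hne : K.Nonempty)
    (hbdd : Bornology.IsBounded K) (hK : IsWeaklySeqClosed K) {x : X}
    (hx : ∀ n : ℕ, x ∉ deficientSet K (1 / ((n : ℝ) + 1))) : (farthestPoints K x).Nonempty := by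
  have hlip := lipschitzWith_farDist hne hbdd
  obtain ⟨f, hf⟩ := (convexOn_farDist hne hbdd).exists_subgradient hlip.continuous x
  have hf1 := norm_le_one_of_subgradient hlip hf
  obtain ⟨k, hk, hfk⟩ := hrefl.exists_forall_le hbdd hK f (m := f x - farDist K x) (by
    intro n
    by_contra! hcon
    refine hx n ⟨f, hf1, hf, fun k hk => ?_⟩
    have := hcon k hk
    rw [map_sub]
    linarith)
  refine ⟨k, hk, (norm_sub_le_farDist hbdd x hk).antisymm ?_⟩
  calc farDist K x ≤ f (x - k) := by rw [map_sub]; linarith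
    _ ≤ ‖f (x - k)‖ := Real.le_norm_self _
    _ ≤ 1 * ‖x - k‖ := f.le_of_opNorm_le hf1 _
    _ = ‖x - k‖ := one_mul _

/-- **Lau's theorem** in reflexive spaces: the points without a farthest point form a meagre
set. -/
theorem isMeagre_setOf_farthestPoints_nonempty_compl (hrefl : IsReflexiveSpace X)
    (hne : K.Nonempty) (hbdd : Bornology.IsBounded K) (hK : IsWeaklySeqClosed K) :
    IsMeagre {x : X | (farthestPoints K x).Nonempty}ᶜ := by
  have hmeagre : IsMeagre (⋃ n : ℕ, deficientSet K (1 / ((n : ℝ) + 1))) :=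
    isMeagre_iUnion fun n => ((isClosed_deficientSet hne hbdd _).isNowhereDense_iff.2
      (interior_deficientSet hne hbdd (by positivity))).isMeagre
  refine hmeagre.mono fun x hx => ?_
  by_contra hcon
  exact hx (farthestPoints_nonempty hrefl hne hbdd hK (by simpa using hcon))

/-- Under property (I), a bounded set with a dense set of points having farthest points lies in
the closed convex hull of those farthest points. -/
theorem HasPropertyI.subset_closedConvexHull_farSet (hI : HasPropertyI X) (hne : K.Nonempty)
    (hbdd : Bornology.IsBounded K) (hdense : Dense {x : X | (farthestPoints K x).Nonempty}) :
    K ⊆ closedConvexHull ℝ (farSet K) := by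
  have hCne : (closedConvexHull ℝ (farSet K)).Nonempty := by
    have : Nonempty X := ⟨0⟩
    obtain ⟨x, k, hk⟩ := hdense.nonempty
    exact ⟨k, subset_closedConvexHull (mem_iUnion.2 ⟨x, hk⟩)⟩
  have hCb : Bornology.IsBounded (closedConvexHull ℝ (farSet K)) := by
    rw [closedConvexHull_eq_closure_convexHull]
    exact (isBounded_convexHull.2 (hbdd.subset farSet_subset)).closure
  obtain ⟨P, -, hP⟩ := hI _ hCne isClosed_closedConvexHull hCb convex_closedConvexHull
  intro k₀ hk₀
  rw [hP, mem_iInter₂]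
  rintro ⟨c, ρ⟩ hp
  rw [Metric.mem_closedBall, dist_eq_norm, norm_sub_rev]
  refine (norm_sub_le_farDist hbdd c hk₀).trans (le_of_forall_pos_le_add fun ε hε => ?_)
  -- Replacing `c` by `x` costs `ε / 2` in `r` and `ε / 2` in the distance to `k`.
  obtain ⟨x, hxc, k, hk⟩ := Metric.dense_iff.1 hdense c (ε / 2) (by positivity)
  have hkC : k ∈ Metric.closedBall c ρ := by
    have : k ∈ closedConvexHull ℝ (farSet K) :=
      subset_closedConvexHull (mem_iUnion.2 ⟨x, hk⟩)
    rw [hP] at this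
    exact mem_iInter₂.1 this (c, ρ) hp
  rw [Metric.mem_closedBall, dist_eq_norm] at hkC
  rw [Metric.mem_ball, dist_eq_norm] at hxc
  have h1 : ‖x - k‖ = farDist K x := hk.2
  have h2 := farDist_le_add hne hbdd c x
  have h3 := norm_sub_le_norm_sub_add_norm_sub x c k
  rw [norm_sub_rev c x] at h2
  rw [norm_sub_rev c k] at h3
  linarith

end FarthestDistance

theorem theorem4p9 {X : Type*} [NormedAddCommGroup X] [NormedSpace ℝ X] [CompleteSpace X]
    (hrefl : IsReflexiveSpace X) (hX : IsHLUR X)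
    (K : Set X) (hne : K.Nonempty) (hbdd : Bornology.IsBounded K) (hK : IsWeaklySeqClosed K) :
    (Dense {x : X | (farthestPoints K x).Nonempty} ∧
      IsMeagre {x : X | (farthestPoints K x).Nonempty}ᶜ) ∧
    (HasPropertyI X → closedConvexHull ℝ K = closedConvexHull ℝ (farSet K)) := by
  have hmeagre := isMeagre_setOf_farthestPoints_nonempty_compl hrefl hne hbdd hK
  have hdense : Dense {x : X | (farthestPoints K x).Nonempty} := by
    rw [IsMeagre, compl_compl] at hmeagre
    exact dense_of_mem_residual hmeagre
  refine ⟨⟨hdense, hmeagre⟩, fun hI => subset_antisymm ?_ ?_⟩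
  · exact closedConvexHull_min (hI.subset_closedConvexHull_farSet hne hbdd hdense)
      convex_closedConvexHull isClosed_closedConvexHull
  · exact (closedConvexHull ℝ).monotone farSet_subset
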